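/- **Setting.** Consider $m$ unmeasured and $n$ ancilla qubits, a Clifford gate $G$ on these $n+m$ qubits, and $\mathcal P^m=\{I,X,Y,Z\}^m$ (Pauli operators modulo phase; $\langle P,Q\rangle\in\{0,1\}$ is $0$ iff $P$ and $Q$ commute). For $x\in\mathbb Z_2^n$ let $Z^x$ act as $Z$ on the ancillas $i$ with $x_i=1$ and trivially on the others. The weight pattern $pt(R)\in\mathbb Z_2^{n+m}$ of a Pauli operator $R$ is $0$ exactly at the qubits on which $R$ is the identity. A noisy mid-circuit measurement (MCM) with ideal gate $G$ and readout $k\in\mathbb Z_2^n$ is $$\mathcal T_k(\rho)=\sum_{a,b\in\mathbb Z_2^n,\,P\in\mathcal P^m}p^P_{a,b}\,(P\otimes|k+b\rangle\langle k+a|)\,G\rho G^\dagger\,(P\otimes|k+a\rangle\langle k+b|),$$ where the Pauli error rates $p^P_{a,b}$ form a probability distribution. Its Pauli fidelities are $\lambda^Q_{x,y}=\sum_{a,b,P}(-1)^{a\cdot x+b\cdot y+\langle P,Q\rangle}p^P_{a,b}$. A noise model consists of an unknown initial state $\rho$, such a noisy MCM, a Pauli channel on $n+m$ qubits following each member $G_i$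 of a given family of Clifford gates, and a Pauli channel, with fidelities depending only on the weight pattern, preceding the terminating measurement. All Pauli fidelities and all Pauli error rates of these noises are strictly positive, and for all $Q\in\mathcal P^m$, $x\in\mathbb Z_2^n$ some Pauli operator $R$ with $pt(R)=pt(G^\dagger(Q\otimes Z^x)G)$ has $\operatorname{Tr}(R\rho)\neq0$. An experiment prepares $\rho$, applies a finite sequence of MCMs, noisy gates $G_i$ and noiseless layers of arbitrary single-qubit unitaries, and ends with an arbitrary POVM measurement subject to the measurement noise. Two noise models (with the same $G$ and $G_i$) are indistinguishable if every experiment has the same joint distribution of all outcomes under both. A real function of the noise model is learnable if it takes equal values on indistinguishable noise models. **Proposition.** For every Clifford $G$, every family $(G_i)$, every $P\in\mathcal P^m$ and all $a\neq0$, $b\neq0$ in $\mathbb Z_2^n$, the Pauli error rate $p^P_{a,b}$ is learnable under the first-order low-noise approximation $\lambda\approx1+\log\lambda$. That is, the function $$\hat p^P_{a,b}=\frac1{4^{n+m}}\sum_{x,y\in\mathbb Z_2^n,\,Q\in\mathcal P^m}(-1)^{a\cdot x+b\cdot y+\langle P,Q\rangle}\bigl(1+\log\lambda^Q_{x,y}\bigr)$$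 is learnable, and $|p^P_{a,b}-\hat p^P_{a,b}|\le\varepsilon^2$ whenever $\varepsilon\le\frac12$ and $|\lambda^Q_{x,y}-1|\le\varepsilon$ for all $x,y,Q$. Moreover, let the pattern transfer graph have vertex set $\mathbb Z_2^{n+m}$ and one edge $e^Q_{x,y}$ from $pt(G^\dagger(Q\otimes Z^x)G)$ to $pt(Q\otimes Z^y)$ for all $x,y\in\mathbb Z_2^n$, $Q\in\mathcal P^m$, and let $\partial$ be its boundary operator (end point minus start point). Then $\hat p^P_{a,b}$ is the value of the real $1$-chain $\mu=\frac1{4^{n+m}}\sum_{x,y,Q}(-1)^{a\cdot x+b\cdot y+\langle P,Q\rangle}e^Q_{x,y}$ with $\log\lambda^Q_{x,y}$ put for $e^Q_{x,y}$, and $\partial\mu=0$. -/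

import Mathlib

namespace MCM

open scoped ComplexOrder

/-! ### Qubits, Pauli operators, Clifford gates -/

/-- Bit strings indexed by `q`; they label the computational basis of the qubits `q`. -/
abbrev Bits (q : Type) : Type := q → ZMod 2

/-- Operators on the Hilbert space of the qubits `q`, in the computational basis. -/
abbrev Op (q : Type) : Type := Matrix (Bits q) (Bits q) ℂ

/-- The sign `(-1)^z` of a bit `z`. -/
def sgn (z : ZMod 2) : ℝ := if z = 0 then 1 else -1

/-- Labels of the four single-qubit Pauli operators. -/
inductive Pauli : Type
  | I | X | Y | Z
  deriving DecidableEq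

instance : Fintype Pauli := ⟨{.I, .X, .Y, .Z}, fun P => by cases P <;> simp⟩

/-- The single-qubit Pauli matrices. -/
def Pauli.mat : Pauli → Matrix (ZMod 2) (ZMod 2) ℂ
  | .I => fun s t => if s = t then 1 else 0
  | .X => fun s t => if s = t then 0 else 1
  | .Y => fun s t => if s = t then 0 else if s = 0 then -Complex.I else Complex.I
  | .Z => fun s t => if s = t then (if s = 0 then 1 else -1) else 0

/-- Pauli operators on the qubits `q`, modulo phase. -/
abbrev PauliString (q : Type) : Type := q → Pauli

section
variable {q : Type} [Fintype q] [DecidableEq q]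

/-- The tensor product of one single-qubit operator for each qubit. -/
def tensor (A : q → Matrix (ZMod 2) (ZMod 2) ℂ) : Op q :=
  fun s t => ∏ i, A i (s i) (t i)

/-- The operator named by a Pauli string. -/
def PauliString.mat (P : PauliString q) : Op q := tensor fun i => (P i).mat

/-- The Pauli weight pattern: bit `i` is `0` iff the operator is the identity on qubit `i`. -/
def PauliString.pattern (P : PauliString q) : Bits q := fun i => if P i = Pauli.I then 0 else 1

open Classical in
/-- `⟨P, Q⟩`, which is `0` if the two Pauli operators commute, and `1` otherwise. -/
noncomputable def pauliInner (P Q : PauliString q) : ZMod 2 :=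
  if P.mat * Q.mat = Q.mat * P.mat then 0 else 1

/-- Clifford gates on the qubits `q`: unitaries that map Pauli operators to Pauli operators,
up to sign, under conjugation. -/
structure Clifford (q : Type) [Fintype q] [DecidableEq q] where
  U : Op q
  unitary : U ∈ Matrix.unitaryGroup (Bits q) ℂ
  normalizes : ∀ P : PauliString q, ∃ Q : PauliString q,
    U * P.mat * U.conjTranspose = Q.mat ∨ U * P.mat * U.conjTranspose = -Q.mat

/-- The channel `ρ ↦ G ρ G†`. -/
def Clifford.conj (G : Clifford q) (ρ : Op q) : Op q := G.U * ρ * G.U.conjTranspose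

open Classical in
/-- The Pauli string of `G† P G`, modulo sign. (For a Clifford gate such a string always
exists and is unique, so that the second branch is never used.) -/
noncomputable def Clifford.pullback (G : Clifford q) (P : PauliString q) : PauliString q :=
  if h : ∃ R : PauliString q, G.U.conjTranspose * P.mat * G.U = R.mat ∨
      G.U.conjTranspose * P.mat * G.U = -R.mat
  then h.choose else P

/-! ### Pauli channels -/

/-- The Pauli fidelity `λ^Q = ∑_P (-1)^⟨P,Q⟩ p^P` of Pauli error rates `p`. -/
noncomputable def pauliFidelity (p : PauliString q → ℝ) (Q : PauliString q) : ℝ :=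
  ∑ P, sgn (pauliInner P Q) * p P

/-- Pauli channels with strictly positive fidelities that do not lie on the boundary of the
completely positive polytope, i.e. whose error rates are all strictly positive. -/
structure PauliChannel (q : Type) [Fintype q] [DecidableEq q] where
  rate : PauliString q → ℝ
  rate_pos : ∀ P, 0 < rate P
  rate_sum : ∑ P, rate P = 1
  fidelity_pos : ∀ Q, 0 < pauliFidelity rate Q

/-- The action `ρ ↦ ∑_P p^P P ρ P†`. -/
noncomputable def PauliChannel.apply (Λ : PauliChannel q) (ρ : Op q) : Op q :=
  ∑ P : PauliString q, (Λ.rate P : ℂ) • (P.mat * ρ * P.mat.conjTranspose)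

/-- A Pauli channel is symmetric if its fidelities only depend on the weight pattern. -/
def PauliChannel.IsSymmetric (Λ : PauliChannel q) : Prop :=
  ∀ P Q : PauliString q, P.pattern = Q.pattern →
    pauliFidelity Λ.rate P = pauliFidelity Λ.rate Q

/-- A finite-outcome POVM. -/
structure POVM (q : Type) [Fintype q] [DecidableEq q] where
  numOutcomes : ℕ
  effect : Fin numOutcomes → Op q
  posSemidef : ∀ j, (effect j).PosSemidef
  sum_effect : ∑ j, effect j = 1

end

/-! ### Noisy mid-circuit measurements on `m` unmeasured qubits and `n` ancillas -/

/-- The qubits: `m` unmeasured ones, followed by `n` ancillas. -/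
abbrev Reg (m n : ℕ) : Type := Fin m ⊕ Fin n

/-- The Pauli string `Q ⊗ Z^x`. -/
def withZ {m n : ℕ} (Q : PauliString (Fin m)) (x : Bits (Fin n)) : PauliString (Reg m n) :=
  Sum.elim Q fun i => if x i = 0 then Pauli.I else Pauli.Z

/-- The Fourier character `(-1)^(a·x + b·y + ⟨P,Q⟩)`. -/
noncomputable def character {m n : ℕ} (a b : Bits (Fin n)) (P : PauliString (Fin m))
    (x y : Bits (Fin n)) (Q : PauliString (Fin m)) : ℝ :=
  sgn (a ⬝ᵥ x + b ⬝ᵥ y + pauliInner P Q)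

/-- The Pauli fidelity `λ_{x,y}^Q` of Pauli error rates `p_{a,b}^P` of an instrument. -/
noncomputable def instrFidelity {m n : ℕ}
    (p : Bits (Fin n) → Bits (Fin n) → PauliString (Fin m) → ℝ)
    (x y : Bits (Fin n)) (Q : PauliString (Fin m)) : ℝ :=
  ∑ a, ∑ b, ∑ P, character a b P x y Q * p a b P

/-- Uniform stochastic instruments, given by their Pauli error rates `p_{a,b}^P`, with strictly
positive Pauli fidelities, and not on the boundary of the completely positive polytope. -/
structure Instrument (m n : ℕ) where
  rate : Bits (Fin n) → Bits (Fin n) → PauliString (Fin m) → ℝ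
  rate_pos : ∀ a b P, 0 < rate a b P
  rate_sum : ∑ a, ∑ b, ∑ P, rate a b P = 1
  fidelity_pos : ∀ x y Q, 0 < instrFidelity rate x y Q

/-- The Kraus operator `P ⊗ |k+b⟩⟨k+a|`. -/
def kraus {m n : ℕ} (P : PauliString (Fin m)) (a b k : Bits (Fin n)) : Op (Reg m n) :=
  fun s t => P.mat (s ∘ Sum.inl) (t ∘ Sum.inl) *
    if s ∘ Sum.inr = k + b ∧ t ∘ Sum.inr = k + a then 1 else 0

/-- The unnormalized branch `U_k` of the instrument for the readout `k`. -/
noncomputable def Instrument.branch {m n : ℕ} (M : Instrument m n) (k : Bits (Fin n))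
    (ρ : Op (Reg m n)) : Op (Reg m n) :=
  ∑ a, ∑ b, ∑ P, (M.rate a b P : ℂ) • (kraus P a b k * ρ * (kraus P a b k).conjTranspose)

/-! ### Noise models, experiments, learnability -/

/-- Noise models for a mid-circuit measurement with ideal Clifford gate `G`, together with
further Clifford gates `gates i`. -/
structure NoiseModel {m n : ℕ} (G : Clifford (Reg m n)) (ι : Type*) where
  /-- the initial state -/
  state : Op (Reg m n)
  state_posSemidef : state.PosSemidef
  state_trace : state.trace = 1
  /-- The initial state is not blind to any of the operators `G†(Q ⊗ Z^x)`: up to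
  single-qubit Clifford gates it has non-zero overlap with each of them. -/
  state_overlap : ∀ (Q : PauliString (Fin m)) (x : Bits (Fin n)), ∃ R : PauliString (Reg m n),
    R.pattern = (G.pullback (withZ Q x)).pattern ∧ (R.mat * state).trace ≠ 0
  /-- the noise after the further Clifford gates -/
  gateNoise : ι → PauliChannel (Reg m n)
  /-- the noisy instrument after the gate `G` -/
  instr : Instrument m n
  /-- the noise before the terminating measurement -/
  measNoise : PauliChannel (Reg m n)
  measNoise_symmetric : measNoise.IsSymmetric

/-- The measurement-free operations: a layer of arbitrary single-qubit unitaries (which is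
noiseless), or one of the further Clifford gates (which is noisy). -/
inductive Gate (m n : ℕ) (ι : Type*)
  | layer (u : Reg m n → Matrix.unitaryGroup (ZMod 2) ℂ)
  | clifford (i : ι)

/-- An experiment: on the initial state, perform a list of gates; then a number of rounds, each
being a mid-circuit measurement followed by a list of gates; then a terminating measurement. -/
structure Experiment (m n : ℕ) (ι : Type*) where
  init : List (Gate m n ι)
  rounds : List (List (Gate m n ι))
  final : POVM (Reg m n)

section
variable {m n : ℕ} {ι : Type*} {G : Clifford (Reg m n)}

/-- The noisy implementation of a gate. -/
noncomputable def NoiseModel.runGate (gates : ι → Clifford (Reg m n)) (N : NoiseModel G ι)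
    (ρ : Op (Reg m n)) : Gate m n ι → Op (Reg m n)
  | .layer u => tensor (fun i => (u i : Matrix (ZMod 2) (ZMod 2) ℂ)) * ρ *
      (tensor fun i => (u i : Matrix (ZMod 2) (ZMod 2) ℂ)).conjTranspose
  | .clifford i => (N.gateNoise i).apply ((gates i).conj ρ)

/-- The noisy mid-circuit measurement `T_k = U_k 𝒢` with readout `k`. -/
noncomputable def NoiseModel.measure (N : NoiseModel G ι) (k : Bits (Fin n))
    (ρ : Op (Reg m n)) : Op (Reg m n) :=
  N.instr.branch k (G.conj ρ)

/-- The unnormalized state after the given rounds, with readouts `k 0, k 1, …`. -/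
noncomputable def NoiseModel.runRounds (gates : ι → Clifford (Reg m n)) (N : NoiseModel G ι) :
    (rounds : List (List (Gate m n ι))) → (Fin rounds.length → Bits (Fin n)) →
      Op (Reg m n) → Op (Reg m n)
  | [], _, ρ => ρ
  | C :: rounds, k, ρ =>
      N.runRounds gates rounds (fun i => k i.succ)
        (C.foldl (N.runGate gates) (N.measure (k ⟨0, Nat.succ_pos _⟩) ρ))

/-- The probability that experiment `E` has mid-circuit readouts `k` and final outcome `j`. -/
noncomputable def NoiseModel.prob (gates : ι → Clifford (Reg m n)) (N : NoiseModel G ι)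
    (E : Experiment m n ι) (k : Fin E.rounds.length → Bits (Fin n))
    (j : Fin E.final.numOutcomes) : ℝ :=
  (E.final.effect j * N.measNoise.apply
    (N.runRounds gates E.rounds k (E.init.foldl (N.runGate gates) N.state))).trace.re

/-- Two noise models are indistinguishable if all experiments have the same outcome
distribution under both. -/
def Indistinguishable (gates : ι → Clifford (Reg m n)) (N₁ N₂ : NoiseModel G ι) : Prop :=
  ∀ (E : Experiment m n ι) (k : Fin E.rounds.length → Bits (Fin n))
    (j : Fin E.final.numOutcomes), N₁.prob gates E k j = N₂.prob gates E k j

/-- A function of the noise model is learnable if it agrees on indistinguishable models. -/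
def Learnable (gates : ι → Clifford (Reg m n)) (f : NoiseModel G ι → ℝ) : Prop :=
  ∀ N₁ N₂ : NoiseModel G ι, Indistinguishable gates N₁ N₂ → f N₁ = f N₂

/-- The Pauli fidelity `λ_{x,y}^Q` of the mid-circuit measurement. -/
noncomputable def NoiseModel.fidelity (N : NoiseModel G ι) (x y : Bits (Fin n))
    (Q : PauliString (Fin m)) : ℝ :=
  instrFidelity N.instr.rate x y Q

/-- The first-order approximation of the Pauli error rate `p_{a,b}^P`: in the inverse Fourier
transform of the fidelities, each `λ` is replaced by `1 + log λ`. -/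
noncomputable def NoiseModel.firstOrderRate (N : NoiseModel G ι) (a b : Bits (Fin n))
    (P : PauliString (Fin m)) : ℝ :=
  (1 / 4 ^ (n + m)) * ∑ x, ∑ y, ∑ Q, character a b P x y Q * (1 + Real.log (N.fidelity x y Q))

/-! ### The pattern transfer graph -/

/-- Real 1-chains: one coefficient for each edge `e_{x,y}^Q` of the pattern transfer graph. -/
abbrev OneChain (m n : ℕ) : Type :=
  Bits (Fin n) → Bits (Fin n) → PauliString (Fin m) → ℝ

/-- Real 0-chains: one coefficient for each vertex, i.e. for each weight pattern. -/
abbrev ZeroChain (m n : ℕ) : Type := Bits (Reg m n) → ℝ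

/-- The boundary operator: `e_{x,y}^Q` goes from `pt(G†(Q ⊗ Z^x))` to `pt(Q ⊗ Z^y)`. -/
noncomputable def boundary (G : Clifford (Reg m n)) (μ : OneChain m n) : ZeroChain m n :=
  ∑ x, ∑ y, ∑ Q, μ x y Q •
    ((Pi.single (withZ Q y).pattern 1 : ZeroChain m n) -
      Pi.single (G.pullback (withZ Q x)).pattern 1)

/-- A 1-chain as a function of the noise model: `e_{x,y}^Q` stands for `log λ_{x,y}^Q`. -/
noncomputable def OneChain.eval (μ : OneChain m n) (N : NoiseModel G ι) : ℝ :=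
  ∑ x, ∑ y, ∑ Q, μ x y Q * Real.log (N.fidelity x y Q)

/-- The Fourier-transformed 1-chain `4^{-(n+m)} ∑ (-1)^(a·x + b·y + ⟨P,Q⟩) e_{x,y}^Q`. -/
noncomputable def fourierChain (a b : Bits (Fin n)) (P : PauliString (Fin m)) : OneChain m n :=
  fun x y Q => (1 / 4 ^ (n + m)) * character a b P x y Q

end

end MCM

namespace MCM

open scoped ComplexOrder

/-! Prepare the state, apply a layer `u` of single-qubit unitaries, perform one mid-circuit
measurement and measure `Q ⊗ Z^y`. Weighting the readouts `k` by `(-1)^((x+y)·k)` turns the outcome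
statistics into `f · λ_{x,y}^Q · r` (`NoiseModel.sum_prob_single_sub`). Here `f` is the fidelity of
the measurement noise at `Q ⊗ Z^y`, and `r` is the overlap of the layered state with `G†(Q ⊗ Z^x)G`.
A suitable `u` makes `r` equal, up to sign, to a nonzero overlap `Tr(Rρ)` supplied by the noise
model. Since `f` depends only on `(y, Q)` and `|r|` only on `(x, Q)`, taking logarithms shows that
between indistinguishable models `log λ_{x,y}^Q` changes by some `A x Q + B y Q`
(`Indistinguishable.exists_log_fidelity_sub_eq`).

The coefficients `(-1)^(a·x + b·y + ⟨P,Q⟩)` annihilate every such change: for `a ≠ 0` they sum to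
zero over `x`, for `b ≠ 0` over `y` (`sum_character_smul_eq_zero_left`,
`sum_character_smul_eq_zero_right`). This gives learnability. It also gives `∂μ = 0`, because the
end of an edge depends only on `(y, Q)` and its start only on `(x, Q)`.

The error bound is independent of this: Fourier inversion writes the rate minus its approximation as
an average of signed terms `λ - (1 + log λ)`, each at most `ε ^ 2` in absolute value. -/

lemma eq_zero_or_one (z : ZMod 2) : z = 0 ∨ z = 1 := by
  revert z; decide

lemma sgn_zero : sgn 0 = 1 := by simp [sgn]

lemma sgn_one : sgn 1 = -1 := by simp [sgn]

lemma sgn_add (z w : ZMod 2) : sgn (z + w) = sgn z * sgn w := by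
  rcases eq_zero_or_one z with rfl | rfl <;> rcases eq_zero_or_one w with rfl | rfl <;>
    simp [sgn_zero, sgn_one, CharTwo.add_self_eq_zero]

lemma sgn_mul_self (z : ZMod 2) : sgn z * sgn z = 1 := by
  rw [← sgn_add, CharTwo.add_self_eq_zero, sgn_zero]

lemma sgn_sum {α : Type*} (s : Finset α) (f : α → ZMod 2) :
    sgn (∑ i ∈ s, f i) = ∏ i ∈ s, sgn (f i) := by
  classical
  induction s using Finset.induction_on with
  | empty => simp [sgn]
  | insert i s hi ih => rw [Finset.sum_insert hi, Finset.prod_insert hi, sgn_add, ih]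

lemma abs_sgn (z : ZMod 2) : |sgn z| = 1 := by
  unfold sgn; split_ifs <;> simp

lemma sum_zmod_two {M : Type*} [AddCommMonoid M] (f : ZMod 2 → M) : ∑ z, f z = f 0 + f 1 := by
  have h : (Finset.univ : Finset (ZMod 2)) = {0, 1} := rfl
  rw [h, Finset.sum_pair (by decide)]

lemma mul_apply_two (A B : Matrix (ZMod 2) (ZMod 2) ℂ) (s t : ZMod 2) :
    (A * B) s t = A s 0 * B 0 t + A s 1 * B 1 t := by
  rw [Matrix.mul_apply, sum_zmod_two]

lemma ext_two {A B : Matrix (ZMod 2) (ZMod 2) ℂ} (h₀₀ : A 0 0 = B 0 0) (h₀₁ : A 0 1 = B 0 1)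
    (h₁₀ : A 1 0 = B 1 0) (h₁₁ : A 1 1 = B 1 1) : A = B := by
  ext s t
  rcases eq_zero_or_one s with rfl | rfl <;> rcases eq_zero_or_one t with rfl | rfl <;> assumption

lemma Pauli.mat_I_apply (s t : ZMod 2) : Pauli.I.mat s t = if s = t then 1 else 0 := rfl

lemma Pauli.mat_X_apply (s t : ZMod 2) : Pauli.X.mat s t = if s = t then 0 else 1 := rfl

lemma Pauli.mat_Y_apply (s t : ZMod 2) :
    Pauli.Y.mat s t = if s = t then 0 else if s = 0 then -Complex.I else Complex.I := rfl

lemma Pauli.mat_Z_apply (s t : ZMod 2) :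
    Pauli.Z.mat s t = if s = t then (if s = 0 then 1 else -1) else 0 := rfl

/-! ### Tensor products, Pauli commutation signs and orthogonality of characters -/

section
variable {q : Type} [Fintype q]

lemma prod_ite_eq_ite {κ R : Type*} [DecidableEq κ] [CommSemiring R]
    (c : R) (a b : q → κ) :
    ∏ i, (if a i = b i then c else 0) = if a = b then c ^ Fintype.card q else 0 := by
  split_ifs with h
  · simp [h]
  · obtain ⟨i, hi⟩ := Function.ne_iff.mp h
    exact Finset.prod_eq_zero (Finset.mem_univ i) (by simp [hi])

lemma tensor_conjTranspose (A : q → Matrix (ZMod 2) (ZMod 2) ℂ) :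
    (tensor A).conjTranspose = tensor fun i => (A i).conjTranspose := by
  ext s t
  simp [tensor]

lemma tensor_smul (c : q → ℂ) (A : q → Matrix (ZMod 2) (ZMod 2) ℂ) :
    (tensor fun i => c i • A i) = (∏ i, c i) • tensor A := by
  ext s t
  simp [tensor, Finset.prod_mul_distrib]

lemma tensor_one : (tensor fun _ => 1 : Op q) = 1 := by
  ext s t
  simp only [tensor, Matrix.one_apply]
  simpa using prod_ite_eq_ite (1 : ℂ) s t

end

section
variable {q : Type} [Fintype q] [DecidableEq q]

lemma sum_prod_eq_prod_sum {κ R : Type*} [Fintype κ] [CommSemiring R] (f : q → κ → R) :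
    ∑ x : q → κ, ∏ i, f i (x i) = ∏ i, ∑ j, f i j := by
  rw [Finset.prod_univ_sum, Fintype.piFinset_univ]

/-- Orthogonality of the characters of `ℤ₂^q`. -/
lemma sum_sgn_dotProduct_mul (a b : Bits q) :
    ∑ x : Bits q, sgn (a ⬝ᵥ x) * sgn (b ⬝ᵥ x) = if a = b then 2 ^ Fintype.card q else 0 := by
  rw [← prod_ite_eq_ite]
  simp only [dotProduct, sgn_sum, ← Finset.prod_mul_distrib]
  rw [sum_prod_eq_prod_sum fun i z => sgn (a i * z) * sgn (b i * z)]
  refine Finset.prod_congr rfl fun i _ => ?_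
  generalize a i = s
  generalize b i = t
  rw [sum_zmod_two]
  rcases eq_zero_or_one s with rfl | rfl <;> rcases eq_zero_or_one t with rfl | rfl <;>
    simp [sgn_zero, sgn_one] <;> norm_num

lemma sum_sgn_dotProduct {a : Bits q} (ha : a ≠ 0) : ∑ x : Bits q, sgn (a ⬝ᵥ x) = 0 := by
  simpa [ha, sgn_zero] using sum_sgn_dotProduct_mul a 0

lemma tensor_mul (A B : q → Matrix (ZMod 2) (ZMod 2) ℂ) :
    tensor A * tensor B = tensor fun i => A i * B i := by
  ext s t
  simp only [Matrix.mul_apply, tensor, ← Finset.prod_mul_distrib]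
  exact sum_prod_eq_prod_sum fun i r => A i (s i) r * B i r (t i)

/-- The sign `s` in `P Q = s Q P`, for single-qubit Pauli operators. -/
def Pauli.commSign (P Q : Pauli) : ℝ := if P = .I ∨ Q = .I ∨ P = Q then 1 else -1

lemma Pauli.mat_mul_comm (P Q : Pauli) :
    P.mat * Q.mat = (P.commSign Q : ℂ) • (Q.mat * P.mat) := by
  cases P <;> cases Q <;> apply ext_two <;>
    simp [Pauli.commSign, mul_apply_two, Pauli.mat_I_apply, Pauli.mat_X_apply, Pauli.mat_Y_apply,
      Pauli.mat_Z_apply]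

lemma Pauli.mat_mul_self (P : Pauli) : P.mat * P.mat = 1 := by
  cases P <;> apply ext_two <;>
    simp [mul_apply_two, Pauli.mat_I_apply, Pauli.mat_X_apply, Pauli.mat_Y_apply, Pauli.mat_Z_apply]

lemma Pauli.mat_conjTranspose (P : Pauli) : P.mat.conjTranspose = P.mat := by
  cases P <;> apply ext_two <;>
    simp [Pauli.mat_I_apply, Pauli.mat_X_apply, Pauli.mat_Y_apply, Pauli.mat_Z_apply]

lemma PauliString.mat_conjTranspose {q : Type} [Fintype q] (P : PauliString q) :
    P.mat.conjTranspose = P.mat := by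
  simp [PauliString.mat, tensor_conjTranspose, Pauli.mat_conjTranspose]

lemma Pauli.sum_commSign_mul (P P' : Pauli) :
    ∑ Q, P.commSign Q * P'.commSign Q = if P = P' then 4 else 0 := by
  have h : (Finset.univ : Finset Pauli) = {.I, .X, .Y, .Z} := rfl
  rw [h]
  cases P <;> cases P' <;> simp [Pauli.commSign] <;> norm_num

lemma PauliString.mat_mul_self (P : PauliString q) : P.mat * P.mat = 1 := by
  simp [PauliString.mat, tensor_mul, Pauli.mat_mul_self, tensor_one]

lemma PauliString.mat_mul_comm_prod (P Q : PauliString q) :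
    P.mat * Q.mat = ((∏ i, (P i).commSign (Q i) : ℝ) : ℂ) • (Q.mat * P.mat) := by
  push_cast
  simp only [PauliString.mat, tensor_mul]
  rw [← tensor_smul]
  congr 1
  funext i
  exact Pauli.mat_mul_comm _ _

/-- Commuting two strings produces the product of the single-qubit signs. This makes the commutation
character multiplicative over qubits, so sums over strings factor. -/
lemma sgn_pauliInner (P Q : PauliString q) :
    sgn (pauliInner P Q) = ∏ i, (P i).commSign (Q i) := by
  have hs : (∏ i, (P i).commSign (Q i)) = 1 ∨ (∏ i, (P i).commSign (Q i)) = -1 := by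
    refine sq_eq_one_iff.mp ?_
    rw [← Finset.prod_pow]
    exact Finset.prod_eq_one fun i _ => by unfold Pauli.commSign; split_ifs <;> norm_num
  have hc := P.mat_mul_comm_prod Q
  unfold pauliInner
  rcases hs with h | h <;> rw [h] at hc ⊢
  · rw [if_pos (by simpa using hc), sgn_zero]
  · rw [if_neg, sgn_one]
    intro h'
    rw [h'] at hc
    -- Commuting and anticommuting at once would force the invertible product `Q.mat * P.mat` to
    -- vanish.
    have h0 : Q.mat * P.mat = 0 := by
      have : (2 : ℂ) • (Q.mat * P.mat) = 0 := by
        rw [two_smul]; nth_rw 1 [hc]; simp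
      simpa using this
    have h1 : (1 : Op q) = 0 := by
      calc (1 : Op q) = Q.mat * (Q.mat * P.mat) * P.mat := by
            rw [← mul_assoc, Q.mat_mul_self, one_mul, P.mat_mul_self]
        _ = 0 := by rw [h0]; simp
    exact one_ne_zero h1

lemma PauliString.mat_mul_comm (P Q : PauliString q) :
    P.mat * Q.mat = (sgn (pauliInner P Q) : ℂ) • (Q.mat * P.mat) := by
  rw [sgn_pauliInner, P.mat_mul_comm_prod]

lemma PauliString.mat_conj (P Q : PauliString q) :
    P.mat * Q.mat * P.mat = (sgn (pauliInner P Q) : ℂ) • Q.mat := by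
  rw [P.mat_mul_comm, Matrix.smul_mul, mul_assoc, P.mat_mul_self, mul_one]

/-- Orthogonality of the characters `⟨P, ·⟩` of the Pauli group. -/
lemma sum_sgn_pauliInner_mul (P P' : PauliString q) :
    ∑ Q, sgn (pauliInner P Q) * sgn (pauliInner P' Q) =
      if P = P' then 4 ^ Fintype.card q else 0 := by
  rw [← prod_ite_eq_ite]
  simp only [sgn_pauliInner, ← Finset.prod_mul_distrib]
  rw [sum_prod_eq_prod_sum fun i Q => (P i).commSign Q * (P' i).commSign Q]
  exact Finset.prod_congr rfl fun i _ => Pauli.sum_commSign_mul _ _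

/-- A sign does not affect commutation relations, so both strings define the same character, and
distinct strings have orthogonal characters. -/
lemma PauliString.eq_of_mat_eq_or_neg {P P' : PauliString q}
    (h : P.mat = P'.mat ∨ P.mat = -P'.mat) : P = P' := by
  have hi (Q : PauliString q) : pauliInner P Q = pauliInner P' Q := by
    unfold pauliInner
    rcases h with h | h <;> rw [h]
    simp only [neg_mul, mul_neg, neg_inj]
  by_contra hne
  have := sum_sgn_pauliInner_mul P P'
  have h4 : Fintype.card Pauli = 4 := rfl
  simp [hi, sgn_mul_self, hne, h4] at this

lemma Clifford.pullback_spec (G : Clifford q) (P : PauliString q) :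
    G.U.conjTranspose * P.mat * G.U = (G.pullback P).mat ∨
      G.U.conjTranspose * P.mat * G.U = -(G.pullback P).mat := by
  have hU : G.U.conjTranspose * G.U = 1 := Matrix.mem_unitaryGroup_iff'.mp G.unitary
  have key (A : Op q) : G.U.conjTranspose * (G.U * A * G.U.conjTranspose) * G.U = A := by
    calc _ = (G.U.conjTranspose * G.U) * A * (G.U.conjTranspose * G.U) := by
          simp only [mul_assoc]
      _ = A := by rw [hU, one_mul, mul_one]
  choose f hf using G.normalizes
  -- Conjugation by `G` permutes the finite set of strings, so every string is, up to sign, the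
  -- image of one, and that one is its pullback.
  have hinj : Function.Injective f := by
    intro A B hAB
    apply PauliString.eq_of_mat_eq_or_neg
    rw [← key A.mat, ← key B.mat]
    rcases hf A with h | h <;> rcases hf B with h' | h' <;> rw [h, h', hAB] <;> simp
  obtain ⟨R, rfl⟩ := Finite.surjective_of_injective hinj P
  have hex : ∃ S : PauliString q, G.U.conjTranspose * (f R).mat * G.U = S.mat ∨
      G.U.conjTranspose * (f R).mat * G.U = -S.mat := by
    refine ⟨R, ?_⟩
    rcases hf R with h | h
    · left; rw [← h, key]
    · right; rw [← neg_eq_iff_eq_neg.mpr h]; rw [mul_neg, neg_mul, key]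
  unfold Clifford.pullback
  rw [dif_pos hex]
  exact hex.choose_spec

end

/-! ### Fourier analysis of the error rates of an instrument -/

section
variable {m n : ℕ}

lemma character_eq (a b : Bits (Fin n)) (P : PauliString (Fin m)) (x y : Bits (Fin n))
    (Q : PauliString (Fin m)) :
    character a b P x y Q = sgn (a ⬝ᵥ x) * sgn (b ⬝ᵥ y) * sgn (pauliInner P Q) := by
  simp [character, sgn_add]

lemma abs_character (a b : Bits (Fin n)) (P : PauliString (Fin m)) (x y : Bits (Fin n))
    (Q : PauliString (Fin m)) : |character a b P x y Q| = 1 := abs_sgn _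

/-- The inner sum over `x` is that of a nontrivial character. Values in a general module let the
same statement serve for logarithms of fidelities and for 0-chains. -/
lemma sum_character_smul_eq_zero_left {V : Type*} [AddCommGroup V] [Module ℝ V]
    {a : Bits (Fin n)} (ha : a ≠ 0) (b : Bits (Fin n)) (P : PauliString (Fin m))
    (f : Bits (Fin n) → PauliString (Fin m) → V) :
    ∑ x, ∑ y, ∑ Q, character a b P x y Q • f y Q = 0 := by
  rw [Finset.sum_comm]
  refine Finset.sum_eq_zero fun y _ => ?_
  rw [Finset.sum_comm]
  refine Finset.sum_eq_zero fun Q _ => ?_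
  simp_rw [← Finset.sum_smul, character_eq, ← Finset.sum_mul, sum_sgn_dotProduct ha, zero_mul,
    zero_smul]

lemma sum_character_smul_eq_zero_right {V : Type*} [AddCommGroup V] [Module ℝ V]
    (a : Bits (Fin n)) {b : Bits (Fin n)} (hb : b ≠ 0) (P : PauliString (Fin m))
    (f : Bits (Fin n) → PauliString (Fin m) → V) :
    ∑ x, ∑ y, ∑ Q, character a b P x y Q • f x Q = 0 := by
  refine Finset.sum_eq_zero fun x _ => ?_
  rw [Finset.sum_comm]
  refine Finset.sum_eq_zero fun Q _ => ?_
  simp_rw [← Finset.sum_smul, character_eq, ← Finset.sum_mul, ← Finset.mul_sum,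
    sum_sgn_dotProduct hb, mul_zero, zero_mul, zero_smul]

lemma sum_character_mul_character (a b a' b' : Bits (Fin n)) (P P' : PauliString (Fin m)) :
    ∑ x, ∑ y, ∑ Q, character a b P x y Q * character a' b' P' x y Q =
      if a = a' ∧ b = b' ∧ P = P' then 4 ^ (n + m) else 0 := by
  have h : ∀ x y Q, character a b P x y Q * character a' b' P' x y Q =
      (sgn (a ⬝ᵥ x) * sgn (a' ⬝ᵥ x)) * ((sgn (b ⬝ᵥ y) * sgn (b' ⬝ᵥ y)) *
        (sgn (pauliInner P Q) * sgn (pauliInner P' Q))) := by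
    intro x y Q; rw [character_eq, character_eq]; ring
  simp_rw [h, ← Finset.mul_sum, ← Finset.sum_mul, sum_sgn_dotProduct_mul, sum_sgn_pauliInner_mul,
    Fintype.card_fin]
  have h4 : (4 : ℝ) ^ (n + m) = 2 ^ n * (2 ^ n * 4 ^ m) := by
    rw [pow_add, ← mul_assoc, ← mul_pow]; norm_num
  by_cases h1 : a = a' <;> by_cases h2 : b = b' <;> by_cases h3 : P = P' <;> simp [h1, h2, h3, h4]

/-- Fourier inversion for the Pauli fidelities of an instrument. -/
lemma rate_eq_sum_instrFidelity (p : Bits (Fin n) → Bits (Fin n) → PauliString (Fin m) → ℝ)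
    (a b : Bits (Fin n)) (P : PauliString (Fin m)) :
    p a b P = (1 / 4 ^ (n + m)) *
      ∑ x, ∑ y, ∑ Q, character a b P x y Q * instrFidelity p x y Q := by
  have h : ∑ x, ∑ y, ∑ Q, character a b P x y Q * instrFidelity p x y Q =
      ∑ a', ∑ b', ∑ P', (∑ x, ∑ y, ∑ Q,
        character a b P x y Q * character a' b' P' x y Q) * p a' b' P' := by
    -- Flattening each triple sum to a sum over a product type reduces the interchange to a single
    -- `Finset.sum_comm`.
    have hl : ∀ F : Bits (Fin n) × Bits (Fin n) × PauliString (Fin m) → ℝ,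
        ∑ a, ∑ b, ∑ P, F (a, b, P) = ∑ v, F v := fun F => by
      simp only [Fintype.sum_prod_type]
    have h1 := hl fun v => character a b P v.1 v.2.1 v.2.2 * instrFidelity p v.1 v.2.1 v.2.2
    have h2 : ∀ x y Q, instrFidelity p x y Q =
        ∑ w : Bits (Fin n) × Bits (Fin n) × PauliString (Fin m),
          character w.1 w.2.1 w.2.2 x y Q * p w.1 w.2.1 w.2.2 := fun x y Q =>
      hl fun w => character w.1 w.2.1 w.2.2 x y Q * p w.1 w.2.1 w.2.2
    have h3 := hl fun w => (∑ x, ∑ y, ∑ Q, character a b P x y Q *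
      character w.1 w.2.1 w.2.2 x y Q) * p w.1 w.2.1 w.2.2
    have h4 := fun w : Bits (Fin n) × Bits (Fin n) × PauliString (Fin m) =>
      hl fun v => character a b P v.1 v.2.1 v.2.2 * character w.1 w.2.1 w.2.2 v.1 v.2.1 v.2.2
    simp only at h1 h3 h4
    rw [h1, h3]
    simp only [h2, h4, Finset.mul_sum, Finset.sum_mul]
    rw [Finset.sum_comm]
    simp only [mul_assoc]
  rw [h]
  simp only [sum_character_mul_character, ite_mul, zero_mul, ite_and]
  simp

lemma sum_const_bits (c : ℝ) :
    ∑ _x : Bits (Fin n), ∑ _y : Bits (Fin n), ∑ _Q : PauliString (Fin m), c =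
      4 ^ (n + m) * c := by
  -- The number of triples is the squared norm of a character, whose values are signs.
  have h := sum_character_mul_character (0 : Bits (Fin n)) 0 0 0
    (fun _ => Pauli.I : PauliString (Fin m)) (fun _ => Pauli.I)
  simp only [character, sgn_mul_self, and_self, if_true] at h
  rw [← h]
  simp only [Finset.sum_mul, one_mul]

end

/-! ### The logarithm to first order -/

lemma abs_sub_one_add_log_le {t ε : ℝ} (hε : ε ≤ 1 / 2) (h : |t - 1| ≤ ε) :
    |t - (1 + Real.log t)| ≤ ε ^ 2 := by
  have ht : 0 < t := by linarith [(abs_le.mp h).1]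
  have hn : ‖((t - 1 : ℝ) : ℂ)‖ = |t - 1| := Complex.norm_real _
  have key := Complex.norm_log_one_add_sub_self_le (z := ((t - 1 : ℝ) : ℂ)) (by rw [hn]; linarith)
  have e : Complex.log (1 + ((t - 1 : ℝ) : ℂ)) - ((t - 1 : ℝ) : ℂ) =
      ((Real.log t - (t - 1) : ℝ) : ℂ) := by
    rw [Complex.ofReal_sub (Real.log t), Complex.ofReal_log ht.le]
    push_cast
    ring_nf
  rw [e, Complex.norm_real, hn, Real.norm_eq_abs] at key
  -- This is where `ε ≤ 1 / 2` enters: the factor 2 cancels the `/ 2` of the remainder bound.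
  have h2 : (1 - |t - 1|)⁻¹ ≤ 2 := by
    rw [inv_le_comm₀ (by linarith) (by norm_num)]; linarith
  calc |t - (1 + Real.log t)| = |Real.log t - (t - 1)| := by rw [abs_sub_comm]; ring_nf
    _ ≤ |t - 1| ^ 2 * (1 - |t - 1|)⁻¹ / 2 := key
    _ ≤ |t - 1| ^ 2 * 2 / 2 := by gcongr
    _ = |t - 1| ^ 2 := by ring
    _ ≤ ε ^ 2 := by gcongr

/-! ### Single-qubit layers, Pauli channels and Pauli measurements -/

lemma Pauli.exists_unitary_conj_eq {A B : Pauli} (h : A = .I ↔ B = .I) :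
    ∃ u : Matrix.unitaryGroup (ZMod 2) ℂ,
      (u : Matrix (ZMod 2) (ZMod 2) ℂ).conjTranspose * A.mat * u = B.mat := by
  by_cases hAB : A = B
  · exact ⟨1, by simp [hAB]⟩
  have hA : A ≠ .I := fun hA => hAB (hA.trans (h.mp hA).symm)
  have hB : B ≠ .I := fun hB => hA (h.mpr hB)
  have hanti : A.mat * B.mat = -(B.mat * A.mat) := by
    rw [A.mat_mul_comm]; simp [Pauli.commSign, hA, hB, hAB]
  have hc : (√2 : ℂ)⁻¹ * (√2 : ℂ)⁻¹ = 1 / 2 := by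
    rw [← mul_inv, ← Complex.ofReal_mul, Real.mul_self_sqrt zero_le_two]; norm_num
  -- Distinct non-identity Paulis anticommute, so the Hadamard-like `(A + B) / √2` is a Hermitian
  -- involution exchanging them.
  set u : Matrix (ZMod 2) (ZMod 2) ℂ := (√2 : ℂ)⁻¹ • (A.mat + B.mat) with hu
  have hstar : u.conjTranspose = u := by
    simp [hu, Matrix.conjTranspose_smul, Pauli.mat_conjTranspose]
  have hsq : u * u = 1 := by
    rw [hu, Matrix.smul_mul, Matrix.mul_smul, smul_smul, hc]
    have : (A.mat + B.mat) * (A.mat + B.mat) = (2 : ℂ) • 1 := by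
      rw [add_mul, mul_add, mul_add, A.mat_mul_self, B.mat_mul_self, hanti, two_smul]; abel
    rw [this, smul_smul]; norm_num
  have hmul : A.mat * u = u * B.mat := by
    rw [hu, Matrix.mul_smul, Matrix.smul_mul, mul_add, add_mul, A.mat_mul_self, B.mat_mul_self,
      add_comm]
  refine ⟨⟨u, ?_⟩, ?_⟩
  · rw [Matrix.mem_unitaryGroup_iff, Matrix.star_eq_conjTranspose, hstar, hsq]
  · change u.conjTranspose * A.mat * u = B.mat
    rw [hstar, mul_assoc, hmul, ← mul_assoc, hsq, one_mul]

section
variable {q : Type} [Fintype q] [DecidableEq q]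

/-- Pauli operators of equal weight pattern are related by a layer of single-qubit gates. -/
lemma PauliString.exists_layer_conj_eq {S R : PauliString q} (h : S.pattern = R.pattern) :
    ∃ u : q → Matrix.unitaryGroup (ZMod 2) ℂ,
      (tensor fun i => (u i : Matrix (ZMod 2) (ZMod 2) ℂ)).conjTranspose * S.mat *
        (tensor fun i => (u i : Matrix (ZMod 2) (ZMod 2) ℂ)) = R.mat := by
  have hi (i : q) : S i = .I ↔ R i = .I := by
    have := congrFun h i
    unfold PauliString.pattern at this
    by_cases h1 : S i = .I <;> by_cases h2 : R i = .I <;> simp_all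
  choose u hu using fun i => Pauli.exists_unitary_conj_eq (hi i)
  refine ⟨u, ?_⟩
  simp only [PauliString.mat, tensor_conjTranspose, tensor_mul, hu]

/-- By cyclicity of the trace the channel acts on the observable, and conjugation by a Pauli
operator only multiplies `W` by a sign. -/
lemma PauliChannel.trace_mat_mul_apply (Λ : PauliChannel q) (W : PauliString q) (σ : Op q) :
    (W.mat * Λ.apply σ).trace = (pauliFidelity Λ.rate W : ℂ) * (W.mat * σ).trace := by
  simp only [PauliChannel.apply, pauliFidelity, Matrix.mul_sum, Matrix.trace_sum]
  push_cast
  rw [Finset.sum_mul]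
  refine Finset.sum_congr rfl fun P _ => ?_
  have h : (W.mat * (P.mat * σ * P.mat)).trace = (P.mat * W.mat * P.mat * σ).trace := by
    rw [← mul_assoc, Matrix.trace_mul_comm]
    simp only [mul_assoc]
  rw [P.mat_conjTranspose, Matrix.mul_smul, Matrix.trace_smul, h, P.mat_conj, Matrix.smul_mul,
    Matrix.trace_smul, smul_eq_mul, smul_eq_mul]
  ring

lemma PauliString.im_trace_mat_mul (R : PauliString q) {ρ : Op q} (hρ : ρ.PosSemidef) :
    (R.mat * ρ).trace.im = 0 := by
  rw [← Complex.conj_eq_iff_im, starRingEnd_apply, ← Matrix.trace_conjTranspose,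
    Matrix.conjTranspose_mul, R.mat_conjTranspose, hρ.isHermitian.eq, Matrix.trace_mul_comm]

lemma posSemidef_of_conjTranspose_eq_of_mul_self {A : Op q} (h : A.conjTranspose = A)
    (h' : A * A = A) : A.PosSemidef := by
  have := Matrix.posSemidef_conjTranspose_mul_self A
  rwa [h, h'] at this

/-- The two-outcome projective measurement of a Pauli operator. -/
noncomputable def PauliString.povm (W : PauliString q) : POVM q where
  numOutcomes := 2
  effect := ![(1 / 2 : ℂ) • (1 + W.mat), (1 / 2 : ℂ) • (1 - W.mat)]
  posSemidef := by
    have h4 : (1 / 2 : ℂ) * (1 / 2) * 2 = 1 / 2 := by norm_num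
    intro j
    fin_cases j
    · apply posSemidef_of_conjTranspose_eq_of_mul_self
      · simp [Matrix.conjTranspose_smul, W.mat_conjTranspose]
      · have : (1 + W.mat) * (1 + W.mat) = (2 : ℂ) • (1 + W.mat) := by
          rw [two_smul, add_mul, mul_add, mul_add, W.mat_mul_self, one_mul, one_mul, mul_one]
          abel
        simp only [Fin.zero_eta, Matrix.cons_val_zero]
        rw [Matrix.smul_mul, Matrix.mul_smul, this, smul_smul, smul_smul, h4]
    · apply posSemidef_of_conjTranspose_eq_of_mul_self
      · simp [Matrix.conjTranspose_smul, W.mat_conjTranspose]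
      · have : (1 - W.mat) * (1 - W.mat) = (2 : ℂ) • (1 - W.mat) := by
          rw [two_smul, sub_mul, mul_sub, mul_sub, W.mat_mul_self, one_mul, one_mul, mul_one]
          abel
        simp only [Fin.mk_one, Matrix.cons_val_one, Matrix.cons_val_fin_one]
        rw [Matrix.smul_mul, Matrix.mul_smul, this, smul_smul, smul_smul, h4]
  sum_effect := by
    rw [Fin.sum_univ_two]
    simp only [Matrix.cons_val_zero, Matrix.cons_val_one, Matrix.cons_val_fin_one]
    rw [← smul_add, add_add_sub_cancel, ← two_smul ℂ (1 : Op q), smul_smul]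
    norm_num

lemma PauliString.povm_effect_sub (W : PauliString q) :
    W.povm.effect (0 : Fin 2) - W.povm.effect (1 : Fin 2) = W.mat := by
  simp only [PauliString.povm, Matrix.cons_val_zero, Matrix.cons_val_one, Matrix.cons_val_fin_one]
  rw [← smul_sub, add_sub_sub_cancel, ← two_smul ℂ W.mat, smul_smul]
  norm_num

end

/-! ### The noisy measurement in the Heisenberg picture -/

section
variable {m n : ℕ}

open scoped Kronecker

/-- The tensor product of an operator on the unmeasured qubits and one on the ancillas. -/
def prodOp (A : Op (Fin m)) (B : Op (Fin n)) : Op (Reg m n) :=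
  (A ⊗ₖ B).submatrix (Equiv.sumArrowEquivProdArrow _ _ _) (Equiv.sumArrowEquivProdArrow _ _ _)

lemma prodOp_mul (A A' : Op (Fin m)) (B B' : Op (Fin n)) :
    prodOp A B * prodOp A' B' = prodOp (A * A') (B * B') := by
  rw [prodOp, prodOp, Matrix.submatrix_mul_equiv, ← Matrix.mul_kronecker_mul, prodOp]

lemma prodOp_conjTranspose (A : Op (Fin m)) (B : Op (Fin n)) :
    (prodOp A B).conjTranspose = prodOp A.conjTranspose B.conjTranspose := by
  rw [prodOp, Matrix.conjTranspose_submatrix, Matrix.conjTranspose_kronecker, prodOp]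

lemma prodOp_smul_smul (c d : ℂ) (A : Op (Fin m)) (B : Op (Fin n)) :
    prodOp (c • A) (d • B) = (c * d) • prodOp A B := by
  ext s t
  simp [prodOp]
  ring

lemma prodOp_sum_smul {α : Type*} (s : Finset α) (c : α → ℂ) (A : Op (Fin m)) (B : α → Op (Fin n)) :
    prodOp A (∑ i ∈ s, c i • B i) = ∑ i ∈ s, c i • prodOp A (B i) := by
  ext u v
  simp only [prodOp, Matrix.submatrix_apply, Matrix.kroneckerMap_apply, Matrix.sum_apply,
    Matrix.smul_apply, Finset.mul_sum, smul_eq_mul]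
  exact Finset.sum_congr rfl fun i _ => by ring

lemma kraus_eq_prodOp (P : PauliString (Fin m)) (a b k : Bits (Fin n)) :
    kraus P a b k = prodOp P.mat (Matrix.single (k + b) (k + a) 1) := by
  ext s t
  simp only [kraus, prodOp, Matrix.submatrix_apply, Matrix.kroneckerMap_apply, Matrix.single_apply,
    Equiv.sumArrowEquivProdArrow, Equiv.coe_fn_mk, eq_comm]

lemma withZ_mat (Q : PauliString (Fin m)) (x : Bits (Fin n)) :
    (withZ Q x).mat = prodOp Q.mat (Matrix.diagonal fun s => (sgn (x ⬝ᵥ s) : ℂ)) := by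
  ext s t
  simp only [PauliString.mat, tensor, Fintype.prod_sum_type, prodOp, Matrix.submatrix_apply,
    Matrix.kroneckerMap_apply, Equiv.sumArrowEquivProdArrow, Equiv.coe_fn_mk, Matrix.diagonal_apply,
    withZ, Sum.elim_inl, Sum.elim_inr]
  congr 1
  have h (i : Fin n) : (if x i = 0 then Pauli.I else Pauli.Z).mat (s (.inr i)) (t (.inr i)) =
      (sgn (x i * s (.inr i)) : ℂ) * if s (.inr i) = t (.inr i) then 1 else 0 := by
    rcases eq_zero_or_one (x i) with hx | hx <;>
      rcases eq_zero_or_one (s (.inr i)) with hs | hs <;>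
      simp [hx, hs, sgn_zero, sgn_one, Pauli.mat_I_apply, Pauli.mat_Z_apply]
  simp only [h, Finset.prod_mul_distrib]
  rw [prod_ite_eq_ite (1 : ℂ) (fun i => s (.inr i)) fun i => t (.inr i), one_pow, mul_ite, mul_one,
    mul_zero, dotProduct, sgn_sum]
  push_cast
  rfl

lemma kraus_conj_withZ (P Q : PauliString (Fin m)) (a b k y : Bits (Fin n)) :
    (kraus P a b k).conjTranspose * (withZ Q y).mat * kraus P a b k =
      (sgn (pauliInner P Q) * sgn (y ⬝ᵥ (k + b)) : ℂ) •
        prodOp Q.mat (Matrix.single (k + a) (k + a) 1) := by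
  rw [kraus_eq_prodOp, withZ_mat, prodOp_conjTranspose, prodOp_mul, prodOp_mul,
    P.mat_conjTranspose, P.mat_conj, ← prodOp_smul_smul]
  congr 1
  rw [Matrix.conjTranspose_single, Matrix.single_mul_mul_single, Matrix.smul_single]
  simp

/-- In the Heisenberg picture, the signed sum over the readouts of a noisy measurement maps
`Q ⊗ Z^y` to `λ_{x,y}^Q Q ⊗ Z^x`. -/
lemma Instrument.sum_trace_withZ_mul_branch (M : Instrument m n) (x y : Bits (Fin n))
    (Q : PauliString (Fin m)) (τ : Op (Reg m n)) :
    ∑ k, (sgn ((x + y) ⬝ᵥ k) : ℂ) * ((withZ Q y).mat * M.branch k τ).trace =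
      (instrFidelity M.rate x y Q : ℂ) * ((withZ Q x).mat * τ).trace := by
  -- The shift by `a` matches the projectors onto `k + a` left by the Kraus operators.
  have hdiag (a : Bits (Fin n)) : Matrix.diagonal (fun s => (sgn (x ⬝ᵥ s) : ℂ)) =
      ∑ k : Bits (Fin n), (sgn (x ⬝ᵥ (k + a)) : ℂ) • Matrix.single (k + a) (k + a) (1 : ℂ) := by
    refine Eq.trans ?_ (Equiv.sum_comp (Equiv.addRight a) fun j : Bits (Fin n) =>
      (sgn (x ⬝ᵥ j) : ℂ) • Matrix.single j j (1 : ℂ)).symm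
    ext s t
    simp only [Matrix.sum_apply, Matrix.smul_apply, Matrix.single_apply, Matrix.diagonal_apply,
      smul_eq_mul, mul_ite, mul_one, mul_zero, ite_and, Finset.sum_ite_eq', Finset.mem_univ,
      if_true]
  have hbranch (k : Bits (Fin n)) : ((withZ Q y).mat * M.branch k τ).trace =
      ∑ a, ∑ b, ∑ P, (M.rate a b P : ℂ) * (sgn (pauliInner P Q) * sgn (y ⬝ᵥ (k + b))) *
        (prodOp Q.mat (Matrix.single (k + a) (k + a) 1) * τ).trace := by
    simp only [Instrument.branch, Matrix.mul_sum, Matrix.trace_sum]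
    refine Finset.sum_congr rfl fun a _ => Finset.sum_congr rfl fun b _ =>
      Finset.sum_congr rfl fun P _ => ?_
    rw [Matrix.mul_smul, Matrix.trace_smul, ← mul_assoc, Matrix.trace_mul_comm, ← mul_assoc,
      ← mul_assoc, kraus_conj_withZ, Matrix.smul_mul, Matrix.trace_smul, smul_eq_mul, smul_eq_mul]
    ring
  have hsum (a b : Bits (Fin n)) (P : PauliString (Fin m)) :
      ∑ k, (sgn ((x + y) ⬝ᵥ k) : ℂ) * ((M.rate a b P : ℂ) *
        (sgn (pauliInner P Q) * sgn (y ⬝ᵥ (k + b))) *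
        (prodOp Q.mat (Matrix.single (k + a) (k + a) 1) * τ).trace) =
      (character a b P x y Q * M.rate a b P : ℂ) * ((withZ Q x).mat * τ).trace := by
    rw [withZ_mat, hdiag a, prodOp_sum_smul, Matrix.sum_mul, Matrix.trace_sum, Finset.mul_sum]
    refine Finset.sum_congr rfl fun k _ => ?_
    rw [Matrix.smul_mul, Matrix.trace_smul, smul_eq_mul, character_eq]
    -- The weight `(x+y)·k` cancels the sign `y·k` and installs `x·k`; what remains beyond `x·(k+a)`
    -- is the character.
    have h1 : sgn ((x + y) ⬝ᵥ k) * sgn (y ⬝ᵥ (k + b)) =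
        sgn (a ⬝ᵥ x) * sgn (b ⬝ᵥ y) * sgn (x ⬝ᵥ (k + a)) := by
      rw [add_dotProduct, dotProduct_add, dotProduct_add, sgn_add, sgn_add, sgn_add,
        dotProduct_comm a, dotProduct_comm b]
      linear_combination (sgn (x ⬝ᵥ k) * sgn (y ⬝ᵥ b)) * sgn_mul_self (y ⬝ᵥ k) -
        (sgn (x ⬝ᵥ k) * sgn (y ⬝ᵥ b)) * sgn_mul_self (x ⬝ᵥ a)
    have h2 := congrArg (fun r : ℝ => (r : ℂ)) h1
    push_cast at h2 ⊢
    linear_combination (M.rate a b P : ℂ) * sgn (pauliInner P Q) *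
      (prodOp Q.mat (Matrix.single (k + a) (k + a) 1) * τ).trace * h2
  simp only [hbranch, Finset.mul_sum]
  rw [Finset.sum_comm]
  unfold instrFidelity
  push_cast
  rw [Finset.sum_mul]
  refine Finset.sum_congr rfl fun a _ => ?_
  rw [Finset.sum_comm, Finset.sum_mul]
  refine Finset.sum_congr rfl fun b _ => ?_
  rw [Finset.sum_comm, Finset.sum_mul]
  exact Finset.sum_congr rfl fun P _ => hsum a b P

end

/-! ### One-round experiments, learnability and the cycle property -/

section
variable {m n : ℕ} {ι : Type*} {G : Clifford (Reg m n)}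

/-- Apply a layer of single-qubit gates, perform one mid-circuit measurement, and measure `W`. -/
noncomputable def Experiment.single (ι : Type*) (u : Reg m n → Matrix.unitaryGroup (ZMod 2) ℂ)
    (W : PauliString (Reg m n)) : Experiment m n ι where
  init := [.layer u]
  rounds := [[]]
  final := W.povm

lemma NoiseModel.prob_single_sub (gates : ι → Clifford (Reg m n)) (N : NoiseModel G ι)
    (u : Reg m n → Matrix.unitaryGroup (ZMod 2) ℂ) (W : PauliString (Reg m n))
    (k : Bits (Fin n)) :
    N.prob gates (.single ι u W) (fun _ => k) (0 : Fin 2) -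
      N.prob gates (.single ι u W) (fun _ => k) (1 : Fin 2) =
    (W.mat * N.measNoise.apply (N.measure k (N.runGate gates N.state (.layer u)))).trace.re := by
  rw [← W.povm_effect_sub, Matrix.sub_mul, Matrix.trace_sub, Complex.sub_re]
  rfl

lemma NoiseModel.sum_prob_single_sub (gates : ι → Clifford (Reg m n)) (N : NoiseModel G ι)
    (x y : Bits (Fin n)) (Q : PauliString (Fin m))
    (u : Reg m n → Matrix.unitaryGroup (ZMod 2) ℂ) :
    ∑ k, sgn ((x + y) ⬝ᵥ k) *
      (N.prob gates (.single ι u (withZ Q y)) (fun _ => k) (0 : Fin 2) -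
        N.prob gates (.single ι u (withZ Q y)) (fun _ => k) (1 : Fin 2)) =
    pauliFidelity N.measNoise.rate (withZ Q y) * N.fidelity x y Q *
      ((withZ Q x).mat * G.conj (N.runGate gates N.state (.layer u))).trace.re := by
  have h := congrArg Complex.re (N.instr.sum_trace_withZ_mul_branch x y Q
    (G.conj (N.runGate gates N.state (.layer u))))
  rw [Complex.re_sum, Complex.re_ofReal_mul] at h
  simp only [Complex.re_ofReal_mul] at h
  simp only [N.prob_single_sub, PauliChannel.trace_mat_mul_apply, Complex.re_ofReal_mul]
  rw [mul_assoc, NoiseModel.fidelity, ← h, Finset.mul_sum]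
  exact Finset.sum_congr rfl fun k _ => by rw [NoiseModel.measure]; ring

/-- Moving `G` and the layer onto the observable yields `R` up to sign. The absolute value absorbs
the sign, which `Clifford.pullback` does not record. -/
lemma NoiseModel.abs_re_trace_withZ_conj (gates : ι → Clifford (Reg m n)) (N : NoiseModel G ι)
    {x : Bits (Fin n)} {Q : PauliString (Fin m)} {R : PauliString (Reg m n)}
    {u : Reg m n → Matrix.unitaryGroup (ZMod 2) ℂ}
    (hu : (tensor fun i => (u i : Matrix (ZMod 2) (ZMod 2) ℂ)).conjTranspose *
      (G.pullback (withZ Q x)).mat * (tensor fun i => (u i : Matrix (ZMod 2) (ZMod 2) ℂ)) =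
        R.mat) :
    |((withZ Q x).mat * G.conj (N.runGate gates N.state (.layer u))).trace.re| =
      |(R.mat * N.state).trace.re| := by
  set V := tensor fun i => (u i : Matrix (ZMod 2) (ZMod 2) ℂ)
  have h : ((withZ Q x).mat * G.conj (N.runGate gates N.state (.layer u))).trace =
      (V.conjTranspose * (G.U.conjTranspose * (withZ Q x).mat * G.U) * V * N.state).trace := by
    change ((withZ Q x).mat * (G.U * (V * N.state * V.conjTranspose) * G.U.conjTranspose)).trace = _
    rw [← mul_assoc, ← mul_assoc, ← mul_assoc, Matrix.trace_mul_comm, ← mul_assoc,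
      Matrix.trace_mul_comm]
    simp only [mul_assoc]
  rw [h]
  rcases G.pullback_spec (withZ Q x) with h' | h' <;> rw [h']
  · rw [hu]
  · rw [mul_neg, neg_mul, neg_mul, hu, Matrix.trace_neg, Complex.neg_re, abs_neg]

/-- For indistinguishable noise models, `log λ_{x,y}^Q` agrees up to functions of `(x, Q)` and
of `(y, Q)`. -/
lemma Indistinguishable.exists_log_fidelity_sub_eq {gates : ι → Clifford (Reg m n)}
    {N₁ N₂ : NoiseModel G ι} (h : Indistinguishable gates N₁ N₂) :
    ∃ A B : Bits (Fin n) → PauliString (Fin m) → ℝ, ∀ x y Q,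
      Real.log (N₁.fidelity x y Q) - Real.log (N₂.fidelity x y Q) = A x Q + B y Q := by
  -- `R` is chosen for `N₁` alone, and the layer derived from it is used in the experiment for both
  -- models.
  choose R hR hR₀ using fun (x : Bits (Fin n)) Q => N₁.state_overlap Q x
  refine ⟨fun x Q => Real.log |((R x Q).mat * N₂.state).trace.re| -
      Real.log |((R x Q).mat * N₁.state).trace.re|,
    fun y Q => Real.log (pauliFidelity N₂.measNoise.rate (withZ Q y)) -
      Real.log (pauliFidelity N₁.measNoise.rate (withZ Q y)), fun x y Q => ?_⟩
  obtain ⟨u, hu⟩ := PauliString.exists_layer_conj_eq (hR x Q).symm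
  have key : pauliFidelity N₁.measNoise.rate (withZ Q y) * N₁.fidelity x y Q *
        |((R x Q).mat * N₁.state).trace.re| =
      pauliFidelity N₂.measNoise.rate (withZ Q y) * N₂.fidelity x y Q *
        |((R x Q).mat * N₂.state).trace.re| := by
    have hs : ∀ N : NoiseModel G ι, pauliFidelity N.measNoise.rate (withZ Q y) *
        N.fidelity x y Q * |((R x Q).mat * N.state).trace.re| =
        |∑ k, sgn ((x + y) ⬝ᵥ k) *
          (N.prob gates (.single ι u (withZ Q y)) (fun _ => k) (0 : Fin 2) -
            N.prob gates (.single ι u (withZ Q y)) (fun _ => k) (1 : Fin 2))| := fun N => by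
      rw [N.sum_prob_single_sub, abs_mul, N.abs_re_trace_withZ_conj gates hu]
      congr 1
      exact (abs_of_pos (mul_pos (N.measNoise.fidelity_pos _) (N.instr.fidelity_pos x y Q))).symm
    have hp : ∀ (k : Bits (Fin n)) (j : Fin 2),
        N₁.prob gates (.single ι u (withZ Q y)) (fun _ => k) j =
          N₂.prob gates (.single ι u (withZ Q y)) (fun _ => k) j :=
      fun k j => h (.single ι u (withZ Q y)) (fun _ => k) j
    rw [hs, hs]
    simp only [hp]
  have f₁ := N₁.measNoise.fidelity_pos (withZ Q y)
  have f₂ := N₂.measNoise.fidelity_pos (withZ Q y)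
  have l₁ : 0 < N₁.fidelity x y Q := N₁.instr.fidelity_pos x y Q
  have l₂ : 0 < N₂.fidelity x y Q := N₂.instr.fidelity_pos x y Q
  -- The overlap is real, so being nonzero it has nonzero real part.
  have r₁ : 0 < |((R x Q).mat * N₁.state).trace.re| := abs_pos.mpr fun h0 =>
    hR₀ x Q (Complex.ext h0 (PauliString.im_trace_mat_mul _ N₁.state_posSemidef))
  -- That `N₂` also overlaps with `R` follows from the equality of the observed quantities.
  have r₂ : 0 < |((R x Q).mat * N₂.state).trace.re| :=
    pos_of_mul_pos_right (key ▸ mul_pos (mul_pos f₁ l₁) r₁) (mul_pos f₂ l₂).le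
  have hlog := congrArg Real.log key
  rw [Real.log_mul (mul_pos f₁ l₁).ne' r₁.ne', Real.log_mul f₁.ne' l₁.ne',
    Real.log_mul (mul_pos f₂ l₂).ne' r₂.ne', Real.log_mul f₂.ne' l₂.ne'] at hlog
  linear_combination hlog

lemma OneChain.eval_sub_eval (μ : OneChain m n) (N₁ N₂ : NoiseModel G ι) :
    μ.eval N₁ - μ.eval N₂ = ∑ x, ∑ y, ∑ Q, μ x y Q *
      (Real.log (N₁.fidelity x y Q) - Real.log (N₂.fidelity x y Q)) := by
  simp only [OneChain.eval, mul_sub, Finset.sum_sub_distrib]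

lemma learnable_eval_fourierChain (gates : ι → Clifford (Reg m n)) {a b : Bits (Fin n)}
    (ha : a ≠ 0) (hb : b ≠ 0) (P : PauliString (Fin m)) :
    Learnable gates fun N : NoiseModel G ι => (fourierChain a b P).eval N := by
  intro N₁ N₂ h
  obtain ⟨A, B, hAB⟩ := h.exists_log_fidelity_sub_eq
  refine sub_eq_zero.mp ?_
  have hA := sum_character_smul_eq_zero_right a hb P A
  have hB := sum_character_smul_eq_zero_left ha b P B
  simp only [smul_eq_mul] at hA hB
  rw [OneChain.eval_sub_eval]
  simp only [hAB, fourierChain, mul_assoc, ← Finset.mul_sum, mul_add, Finset.sum_add_distrib, hA,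
    hB, add_zero, mul_zero]

/-- The constant 1 in `1 + log λ` contributes a full character sum, which vanishes already because
`a ≠ 0`. -/
lemma NoiseModel.firstOrderRate_eq_eval (N : NoiseModel G ι) {a : Bits (Fin n)} (ha : a ≠ 0)
    (b : Bits (Fin n)) (P : PauliString (Fin m)) :
    N.firstOrderRate a b P = (fourierChain a b P).eval N := by
  have h := sum_character_smul_eq_zero_left ha b P fun _ _ => (1 : ℝ)
  simp only [smul_eq_mul, mul_one] at h
  simp only [NoiseModel.firstOrderRate, OneChain.eval, fourierChain, mul_add, mul_one, mul_assoc,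
    ← Finset.mul_sum, Finset.sum_add_distrib, h, zero_add]

lemma NoiseModel.abs_rate_sub_firstOrderRate_le (N : NoiseModel G ι) (a b : Bits (Fin n))
    (P : PauliString (Fin m)) {ε : ℝ} (hε : ε ≤ 1 / 2)
    (h : ∀ x y Q, |N.fidelity x y Q - 1| ≤ ε) :
    |N.instr.rate a b P - N.firstOrderRate a b P| ≤ ε ^ 2 := by
  have h0 : (0 : ℝ) < 4 ^ (n + m) := by positivity
  -- Spreading `4 ^ (n + m) * ε ^ 2` as a constant triple sum allows a termwise comparison.
  rw [rate_eq_sum_instrFidelity N.instr.rate, NoiseModel.firstOrderRate, ← mul_sub, abs_mul,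
    abs_of_pos (by positivity), one_div, inv_mul_le_iff₀ h0, ← sum_const_bits]
  simp only [← Finset.sum_sub_distrib, ← mul_sub]
  refine (Finset.abs_sum_le_sum_abs _ _).trans (Finset.sum_le_sum fun x _ => ?_)
  refine (Finset.abs_sum_le_sum_abs _ _).trans (Finset.sum_le_sum fun y _ => ?_)
  refine (Finset.abs_sum_le_sum_abs _ _).trans (Finset.sum_le_sum fun Q _ => ?_)
  rw [abs_mul, abs_character, one_mul]
  exact abs_sub_one_add_log_le hε (h x y Q)

lemma boundary_fourierChain (G : Clifford (Reg m n)) {a b : Bits (Fin n)} (ha : a ≠ 0)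
    (hb : b ≠ 0) (P : PauliString (Fin m)) : boundary G (fourierChain a b P) = 0 := by
  have h₁ := sum_character_smul_eq_zero_left ha b P fun y Q =>
    (Pi.single (withZ Q y).pattern 1 : ZeroChain m n)
  have h₂ := sum_character_smul_eq_zero_right a hb P fun x Q =>
    (Pi.single (G.pullback (withZ Q x)).pattern 1 : ZeroChain m n)
  simp only [boundary, fourierChain, mul_smul, smul_sub, ← Finset.smul_sum,
    Finset.sum_sub_distrib, h₁, h₂, smul_zero, sub_zero]

end

end MCM

theorem proposition1 {m n : ℕ} {ι : Type*} (G : MCM.Clifford (MCM.Reg m n))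
    (gates : ι → MCM.Clifford (MCM.Reg m n)) (P : MCM.PauliString (Fin m))
    (a b : MCM.Bits (Fin n)) (ha : a ≠ 0) (hb : b ≠ 0) :
    MCM.Learnable gates (fun N : MCM.NoiseModel G ι => N.firstOrderRate a b P) ∧
    (∀ (N : MCM.NoiseModel G ι) (ε : ℝ), ε ≤ 1 / 2 →
      (∀ x y Q, |N.fidelity x y Q - 1| ≤ ε) →
      |N.instr.rate a b P - N.firstOrderRate a b P| ≤ ε ^ 2) ∧
    (∀ N : MCM.NoiseModel G ι,
      N.firstOrderRate a b P = (MCM.fourierChain a b P).eval N) ∧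
    MCM.boundary G (MCM.fourierChain a b P) = 0 := by
  refine ⟨?_, fun N ε hε h => N.abs_rate_sub_firstOrderRate_le a b P hε h,
    fun N => N.firstOrderRate_eq_eval ha b P, MCM.boundary_fourierChain G ha hb P⟩
  simp only [MCM.NoiseModel.firstOrderRate_eq_eval _ ha]
  exact MCM.learnable_eval_fourierChain gates ha hb P
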